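/- For an integer $n\ge 1$ and a real $\beta$, let $X_1,\dots,X_n$ be independent with $\mathbb{P}(X_k=1)=\mathbb{P}(X_k=-1)=\tfrac12$, let $S_n=X_1+\dots+X_n$, and let the Curie–Weiss spins $(X_1^{(\beta)},\dots,X_n^{(\beta)})$ have the law of $(X_1,\dots,X_n)$ tilted by $e^{\frac{\beta}{2n}S_n^2}$, that is, $$\mathbb{E}\,f\big(X_1^{(\beta)},\dots,X_n^{(\beta)}\big)=\frac{\mathbb{E}\big[e^{\frac{\beta}{2n}S_n^2}f(X_1,\dots,X_n)\big]}{\mathbb{E}\big[e^{\frac{\beta}{2n}S_n^2}\big]}$$ for all bounded measurable $f$. Let $M_n^{(\beta)}=\sum_{k=1}^n X_k^{(\beta)}$ be the magnetisation. There is an absolute constant $C>0$ and, for every $\beta<1$, a constant $C(\beta)>0$ depending only on $\beta$, such that the following holds. Let $\beta<1$ and $Z_\beta\sim\mathscr{N}\big(0,\tfrac1{1-\beta}\big)$. For every $n\ge1$ and every $h\in\mathcal{C}^1(\mathbb{R},\mathbb{R})$ with $\|h\|_\infty<\infty$ and $\|h'\|_\infty<\infty$, $$\left|\mathbb{E}\,h\!\left(\frac{M_n^{(\beta)}}{\sqrt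 n}\right)-\mathbb{E}\,h(Z_\beta)\right|\le \frac{C\,\|h'\|_\infty}{\sqrt n}+\frac1n\left(\frac{\beta}{1-\beta}\|h'\|_\infty+C(\beta)\|h\|_\infty\right).$$ -/

import Mathlib

open MeasureTheory ProbabilityTheory

/-- The law `Ber_{±1}(1/2)` of a fair spin: mass `1/2` at `1` and mass `1/2` at `-1`. -/
noncomputable def fairSpin : Measure ℝ :=
  (2⁻¹ : ENNReal) • (Measure.dirac (1 : ℝ) + Measure.dirac (-1 : ℝ))

instance fairSpin_isProbabilityMeasure : IsProbabilityMeasure fairSpin :=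
  ⟨by simp [fairSpin, ENNReal.inv_two_add_inv_two]⟩

/-- The (unnormalised) magnetisation of a configuration: the sum of its spins. -/
def magnetisation {n : ℕ} (x : Fin n → ℝ) : ℝ := ∑ k, x k

/-- The Curie-Weiss model of `n` spins at inverse temperature `β`, without external field: the law
of `n` independent fair spins, tilted by `exp (β / (2 n) * S ^ 2)`, where `S` is the sum of the
spins. `Measure.tilted` includes the normalisation by the expectation of the tilting factor. -/
noncomputable def curieWeiss (n : ℕ) (β : ℝ) : Measure (Fin n → ℝ) :=
  (Measure.pi fun _ : Fin n => fairSpin).tilted fun x => β / (2 * n) * magnetisation x ^ 2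

/-- The supremum norm of a real function, used for bounded functions only. -/
noncomputable def supNorm (f : ℝ → ℝ) : ℝ := ⨆ x, |f x|

/-- The tilting factor is integrable, so that the Curie-Weiss model is a probability measure. -/
instance curieWeiss_isProbabilityMeasure (n : ℕ) (β : ℝ) :
    IsProbabilityMeasure (curieWeiss n β) := by
  apply isProbabilityMeasure_tilted
  have hs : ∀ᵐ y ∂fairSpin, |y| ≤ 1 := by
    unfold fairSpin
    apply Measure.ae_smul_measure
    rw [ae_add_measure_iff, ae_dirac_eq, ae_dirac_eq]
    simp
  have hx : ∀ᵐ x ∂(Measure.pi fun _ : Fin n => fairSpin), ∀ k, |x k| ≤ 1 := by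
    rw [ae_all_iff]
    intro k
    exact (measurePreserving_eval (fun _ : Fin n => fairSpin) k).quasiMeasurePreserving.ae hs
  refine Integrable.of_bound (C := Real.exp (|β / (2 * n)| * (n : ℝ) ^ 2)) ?_ ?_
  · unfold magnetisation
    exact (by fun_prop : Measurable _).aestronglyMeasurable
  · filter_upwards [hx] with x h
    rw [Real.norm_eq_abs, Real.abs_exp, Real.exp_le_exp]
    have h1 : |magnetisation x| ≤ n := by
      unfold magnetisation
      refine (Finset.abs_sum_le_sum_abs _ _).trans ?_
      refine (Finset.sum_le_sum fun k _ => h k).trans ?_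
      simp
    calc β / (2 * n) * magnetisation x ^ 2 ≤ |β / (2 * n)| * magnetisation x ^ 2 := by
          gcongr; exact le_abs_self _
      _ ≤ |β / (2 * n)| * (n : ℝ) ^ 2 := by
          gcongr ?_ * ?_
          rw [← sq_abs]; gcongr

/-! Stein's method, driven by single spin flips. Flipping one spin preserves the law of fair spins;
a suitably weighted form of this symmetry gives an exact identity for the tilted law
(`curieWeiss_stein_identity`) with rates (1 ∓ t) exp(±βt), t = M/n. Their even part is 2 + O(t²) and
their odd part -2(1-β)t + O(t³). Hence, in the variable x = M/√n, the identity is -2/√n times the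
Stein operator f' - (1-β)xf of N(0, 1/(1-β)), up to an error (`abs_discrete_stein_add_le`).

It is applied to the solution f of f' - (1-β)xf = h - E h(Z) (`exists_stein_solution_of_variance`).
There f and f' are controlled by ‖h‖, while f' is Lipschitz with constant 12‖h'‖ whatever β is; this
yields the absolute constant at order 1/√n. The other errors are of order 1/n, once fourth moments
are bounded uniformly in n by a Hubbard-Stratonovich argument
(`exists_fourth_moment_curieWeiss_le`).

One of them is a β-dependent multiple of ‖h'‖/n, which the claim does not allow. It is absorbed by
‖h'‖/√n for large n; for the remaining n the trivial bound 2‖h‖ suffices. -/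

open Filter Topology

/-! ### The Gaussian Stein equation -/

/-- One-sided comparison for the Stein equation `F' = x F + H` on the right half-line. -/
lemma stein_lower_bound_of_nonneg {F H : ℝ → ℝ} {A B : ℝ} (hA : 0 ≤ A)
    (hF : ∀ x, HasDerivAt F (x * F x + H x) x) (hH : ∀ x, 0 ≤ x → H x ≤ A + B * x)
    (hlim : Tendsto (fun x => F x * Real.exp (-x ^ 2 / 2)) atTop (𝓝 0)) {x : ℝ} (hx : 0 ≤ x) :
    -(2 * A / (1 + x) + B) ≤ F x := by
  -- The barrier 2A/(1+y) + B makes u nonincreasing; since u tends to 0 at infinity, u ≥ 0.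
  set u : ℝ → ℝ := fun y => (F y + (2 * A / (1 + y) + B)) * Real.exp (-y ^ 2 / 2) with hu
  have hexp : ∀ y : ℝ, HasDerivAt (fun y : ℝ => Real.exp (-y ^ 2 / 2))
      (Real.exp (-y ^ 2 / 2) * (-y)) y := by
    intro y
    have h1 : HasDerivAt (fun y : ℝ => -y ^ 2 / 2) (-y) y := by
      have := ((hasDerivAt_pow 2 y).neg).div_const 2
      refine this.congr_deriv ?_
      push_cast; ring
    exact h1.exp
  have hder : ∀ y, 0 ≤ y → HasDerivAt u ((y * F y + H y - 2 * A / (1 + y) ^ 2) *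
      Real.exp (-y ^ 2 / 2) + (F y + (2 * A / (1 + y) + B)) *
        (Real.exp (-y ^ 2 / 2) * (-y))) y := by
    intro y hy
    have h2 : HasDerivAt (fun y : ℝ => 2 * A / (1 + y) + B) (-(2 * A / (1 + y) ^ 2)) y := by
      have h3 : HasDerivAt (fun y : ℝ => 1 + y) 1 y := (hasDerivAt_id y).const_add 1
      have := ((hasDerivAt_const y (2 * A)).div h3 (by positivity)).add_const B
      refine this.congr_deriv ?_
      ring
    refine (((hF y).add h2).mul (hexp y)).congr_deriv ?_
    simp only [Pi.add_apply]
    ring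
  have hanti : AntitoneOn u (Set.Ici 0) := by
    refine antitoneOn_of_deriv_nonpos (convex_Ici 0)
      (fun y hy => (hder y hy).continuousAt.continuousWithinAt)
      (fun y hy => (hder y (interior_subset hy)).differentiableAt.differentiableWithinAt) ?_
    intro y hy
    have hy0 : 0 ≤ y := interior_subset hy
    rw [(hder y hy0).deriv]
    have hE := Real.exp_pos (-y ^ 2 / 2)
    have h4 : 2 * A / (1 + y) ^ 2 + 2 * A / (1 + y) * y - A = A * (1 + y ^ 2) / (1 + y) ^ 2 := by
      field_simp
      ring
    have h5 : 0 ≤ A * (1 + y ^ 2) / (1 + y) ^ 2 := by positivity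
    have h6 := hH y hy0
    have : (y * F y + H y - 2 * A / (1 + y) ^ 2) *
      Real.exp (-y ^ 2 / 2) + (F y + (2 * A / (1 + y) + B)) *
        (Real.exp (-y ^ 2 / 2) * (-y)) =
        (H y - B * y - 2 * A / (1 + y) ^ 2 - 2 * A / (1 + y) * y) * Real.exp (-y ^ 2 / 2) := by
      ring
    rw [this]
    exact mul_nonpos_of_nonpos_of_nonneg (by linarith) hE.le
  have hexp0 : Tendsto (fun y : ℝ => Real.exp (-y ^ 2 / 2)) atTop (𝓝 0) := by
    refine Real.tendsto_exp_atBot.comp ?_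
    have : Tendsto (fun y : ℝ => y ^ 2 / 2) atTop atTop :=
      (tendsto_pow_atTop two_ne_zero).atTop_div_const (by norm_num)
    refine (tendsto_neg_atTop_atBot.comp this).congr fun y => ?_
    simp only [Function.comp]; ring
  have hlimu : Tendsto u atTop (𝓝 0) := by
    have h7 : Tendsto (fun y : ℝ => 2 * A / (1 + y) + B) atTop (𝓝 (0 + B)) :=
      (Tendsto.div_atTop tendsto_const_nhds
        (tendsto_atTop_add_const_left _ _ tendsto_id)).add_const B
    have := hlim.add (h7.mul hexp0)
    simp only [mul_zero, add_zero] at this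
    refine this.congr fun y => ?_
    simp only [hu]; ring
  have h0 : 0 ≤ u x := by
    refine le_of_tendsto hlimu ?_
    filter_upwards [eventually_ge_atTop x] with y hy
    exact hanti hx (hx.trans hy) hy
  have h8 : 0 ≤ F x + (2 * A / (1 + x) + B) :=
    nonneg_of_mul_nonneg_left h0 (Real.exp_pos _)
  linarith

lemma stein_bound_of_nonneg {F H : ℝ → ℝ} {A B : ℝ} (hA : 0 ≤ A)
    (hF : ∀ x, HasDerivAt F (x * F x + H x) x) (hH : ∀ x, |H x| ≤ A + B * |x|)
    (hlim : Tendsto (fun x => F x * Real.exp (-x ^ 2 / 2)) atTop (𝓝 0)) {x : ℝ} (hx : 0 ≤ x) :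
    |F x| ≤ 2 * A / (1 + x) + B := by
  rw [abs_le]
  constructor
  · refine stein_lower_bound_of_nonneg hA hF (fun y hy => ?_) hlim hx
    have := hH y
    rw [abs_of_nonneg hy] at this
    exact (le_abs_self _).trans this
  · have := stein_lower_bound_of_nonneg (F := fun y => -F y) (H := fun y => -H y) (B := B) hA
      (fun y => (hF y).neg.congr_deriv (by ring)) (fun y hy => ?_)
      (by simpa [neg_mul] using hlim.neg) hx
    · linarith
    · have := hH y
      rw [abs_of_nonneg hy] at this
      exact (neg_le_abs _).trans this

/-- A solution of the Stein equation `F' = x F + H` that is negligible against `exp (x ^ 2 / 2)`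
is controlled by an affine bound on `H`. -/
lemma stein_bound {F H : ℝ → ℝ} {A B : ℝ} (hA : 0 ≤ A)
    (hF : ∀ x, HasDerivAt F (x * F x + H x) x) (hH : ∀ x, |H x| ≤ A + B * |x|)
    (hlim : Tendsto (fun x => F x * Real.exp (-x ^ 2 / 2)) atTop (𝓝 0))
    (hlim' : Tendsto (fun x => F x * Real.exp (-x ^ 2 / 2)) atBot (𝓝 0)) (x : ℝ) :
    |F x| ≤ 2 * A / (1 + |x|) + B := by
  rcases le_total 0 x with hx | hx
  · rw [abs_of_nonneg hx]
    exact stein_bound_of_nonneg hA hF hH hlim hx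
  · rw [abs_of_nonpos hx]
    have := stein_bound_of_nonneg (F := fun y => F (-y)) (H := fun y => -H (-y)) (B := B) hA
      (fun y => ?_) (fun y => by simpa using hH (-y)) ?_ (neg_nonneg.2 hx)
    · simpa using this
    · have h1 := (hF (-y)).comp y (hasDerivAt_neg y)
      refine h1.congr_deriv ?_
      ring
    · refine (hlim'.comp tendsto_neg_atTop_atBot).congr fun y => ?_
      simp

lemma abs_mul_le_of_le_div_one_add_abs {f A x : ℝ} (hA : 0 ≤ A)
    (hf : |f| ≤ A / (1 + |x|)) : |x * f| ≤ A := by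
  have h0 := abs_nonneg x
  rw [abs_mul]
  calc |x| * |f| ≤ |x| * (A / (1 + |x|)) := by gcongr
    _ = A * (|x| / (1 + |x|)) := by ring
    _ ≤ A * 1 := by
      gcongr
      rw [div_le_one (by positivity)]
      linarith
    _ = A := mul_one A

lemma abs_le_of_le_div_one_add_abs {f A x : ℝ} (hA : 0 ≤ A)
    (hf : |f| ≤ A / (1 + |x|)) : |f| ≤ A :=
  hf.trans (div_le_self hA (by linarith [abs_nonneg x]))

/-- Multiply the primitive of H exp(-y²/2) started at -∞ by exp(x²/2). Centring of H makes this
primitive vanish at +∞ as well, which gives both limits required by `stein_bound`. -/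
lemma exists_stein_solution {H : ℝ → ℝ} (hH : Continuous H) {K : ℝ} (hK : ∀ x, |H x| ≤ K)
    (h0 : ∫ x, H x ∂(gaussianReal 0 1) = 0) :
    ∃ F : ℝ → ℝ, (∀ x, HasDerivAt F (x * F x + H x) x) ∧
      Tendsto (fun x => F x * Real.exp (-x ^ 2 / 2)) atTop (𝓝 0) ∧
      Tendsto (fun x => F x * Real.exp (-x ^ 2 / 2)) atBot (𝓝 0) := by
  set g : ℝ → ℝ := fun x => H x * Real.exp (-x ^ 2 / 2) with hg
  have hgc : Continuous g := by fun_prop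
  have hgi : Integrable g := by
    have h1 : Integrable fun x : ℝ => Real.exp (-x ^ 2 / 2) := by
      have := integrable_exp_neg_mul_sq (b := 1 / 2) (by norm_num)
      refine this.congr (ae_of_all _ fun x => ?_)
      ring_nf
    exact h1.bdd_mul hH.aestronglyMeasurable (ae_of_all _ fun x => by simpa using hK x)
  have hg0 : ∫ x, g x = 0 := by
    rw [integral_gaussianReal_eq_integral_smul one_ne_zero] at h0
    simp only [gaussianPDFReal, smul_eq_mul, NNReal.coe_one, mul_one, sub_zero] at h0
    simp_rw [mul_assoc, integral_const_mul] at h0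
    have h2 : (√(2 * Real.pi))⁻¹ ≠ 0 := by positivity
    rw [mul_eq_zero, or_iff_right h2] at h0
    rw [← h0]
    exact integral_congr_ae (ae_of_all _ fun x => by simp only [hg]; ring)
  set c : ℝ := ∫ x in Set.Iic 0, g x with hc
  set G : ℝ → ℝ := fun x => c + ∫ y in (0:ℝ)..x, g y with hG
  have hGd : ∀ x, HasDerivAt G (g x) x := fun x =>
    (intervalIntegral.integral_hasDerivAt_right (hgc.intervalIntegrable _ _)
      hgc.aestronglyMeasurable.stronglyMeasurableAtFilter hgc.continuousAt).const_add c
  have hc' : c + ∫ x in Set.Ioi 0, g x = 0 := by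
    rw [hc, intervalIntegral.integral_Iic_add_Ioi hgi.integrableOn hgi.integrableOn, hg0]
  have hmul : ∀ x : ℝ, Real.exp (x ^ 2 / 2) * Real.exp (-x ^ 2 / 2) = 1 := by
    intro x
    rw [← Real.exp_add, ← Real.exp_zero]; congr 1; ring
  have hcancel : ∀ x : ℝ, G x * Real.exp (x ^ 2 / 2) * Real.exp (-x ^ 2 / 2) = G x := by
    intro x
    rw [mul_assoc, hmul, mul_one]
  refine ⟨fun x => G x * Real.exp (x ^ 2 / 2), fun x => ?_, ?_, ?_⟩
  · have h1 : HasDerivAt (fun y : ℝ => y ^ 2 / 2) x x := by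
      have := (hasDerivAt_pow 2 x).div_const 2
      refine this.congr_deriv ?_
      push_cast; ring
    have h2 := (hGd x).mul h1.exp
    refine h2.congr_deriv ?_
    have : g x * Real.exp (x ^ 2 / 2) = H x := by
      simp only [hg]
      rw [mul_assoc, mul_comm (Real.exp _), hmul, mul_one]
    rw [this]
    ring
  · simp_rw [hcancel]
    have := intervalIntegral_tendsto_integral_Ioi (0:ℝ) hgi.integrableOn tendsto_id
    have h3 := this.const_add c
    rw [hc'] at h3
    exact h3
  · simp_rw [hcancel]
    have := intervalIntegral_tendsto_integral_Iic (0:ℝ) hgi.integrableOn tendsto_id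
    have h3 := this.const_sub c
    rw [← hc, sub_self] at h3
    refine h3.congr fun x => ?_
    simp only [hG, id]
    rw [intervalIntegral.integral_symm x 0, sub_eq_add_neg]

lemma tendsto_affine_mul_exp_neg_sq (A B : ℝ) :
    Tendsto (fun x : ℝ => (A + B * |x|) * Real.exp (-x ^ 2 / 2)) (cocompact ℝ) (𝓝 0) := by
  have h1 := tendsto_rpow_abs_mul_exp_neg_mul_sq_cocompact (a := 1 / 2) (by norm_num) 0
  have h2 := tendsto_rpow_abs_mul_exp_neg_mul_sq_cocompact (a := 1 / 2) (by norm_num) 1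
  have := (h1.const_mul A).add (h2.const_mul B)
  simp only [mul_zero, add_zero, Real.rpow_zero, Real.rpow_one] at this
  refine this.congr fun x => ?_
  rw [show -x ^ 2 / 2 = -(1 / 2) * x ^ 2 by ring]
  ring

/-- Provides the affine growth, in terms of the Lipschitz constant alone, that `stein_bound` takes
as input. -/
lemma abs_sub_integral_gaussianReal_le {h : ℝ → ℝ} (hc : Continuous h) {K L : ℝ}
    (hK : ∀ x, |h x| ≤ K) (hL : ∀ x y, |h x - h y| ≤ L * |x - y|) (hL0 : 0 ≤ L) (x : ℝ) :
    |h x - ∫ z, h z ∂(gaussianReal 0 1)| ≤ L + L * |x| := by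
  have hint : Integrable h (gaussianReal 0 1) :=
    Integrable.of_bound hc.aestronglyMeasurable K (ae_of_all _ hK)
  have hsq : Integrable (fun z : ℝ => z ^ 2) (gaussianReal 0 1) := by
    simpa using (memLp_id_gaussianReal (μ := 0) (v := 1) 2).integrable_sq
  have hvar : ∫ z : ℝ, z ^ 2 ∂(gaussianReal 0 1) = 1 := by
    have := variance_id_gaussianReal (μ := 0) (v := 1)
    rw [variance_of_integral_eq_zero (by fun_prop) (by simp)] at this
    simpa using this
  have h1 : h x - ∫ z, h z ∂(gaussianReal 0 1) = ∫ z, (h x - h z) ∂(gaussianReal 0 1) := by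
    rw [integral_sub (integrable_const _) hint]; simp
  rw [h1]
  have hint2 : Integrable (fun z : ℝ => L * (|x| + (1 + z ^ 2) / 2)) (gaussianReal 0 1) := by
    fun_prop
  calc |∫ z, (h x - h z) ∂(gaussianReal 0 1)|
      ≤ ∫ z, |h x - h z| ∂(gaussianReal 0 1) := abs_integral_le_integral_abs
    _ ≤ ∫ z, L * (|x| + (1 + z ^ 2) / 2) ∂(gaussianReal 0 1) := by
        refine integral_mono (by fun_prop) hint2 fun z => (hL x z).trans ?_
        -- Gives E|Z| ≤ 1 from the variance alone.
        have h2 : |z| ≤ (1 + z ^ 2) / 2 := by nlinarith [sq_nonneg (|z| - 1), sq_abs z]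
        have h3 := abs_sub x z
        gcongr
        linarith
    _ = L * (|x| + (1 + 1) / 2) := by
        rw [integral_const_mul, integral_add (by fun_prop) (by fun_prop), integral_div,
          integral_add (by fun_prop) hsq, hvar]
        simp
    _ = L + L * |x| := by ring

/-- Stein's solution for the standard Gaussian and a bounded `C¹` test function. -/
lemma exists_stein_solution_standard {h : ℝ → ℝ} (hc : ContDiff ℝ 1 h) {K L : ℝ}
    (hK : ∀ x, |h x| ≤ K) (hL : ∀ x, |deriv h x| ≤ L) :
    ∃ F F' : ℝ → ℝ, (∀ x, HasDerivAt F (F' x) x) ∧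
      (∀ x, F' x = x * F x + (h x - ∫ z, h z ∂(gaussianReal 0 1))) ∧
      (∀ x, |F x| ≤ 4 * K) ∧ (∀ x, |F' x| ≤ 6 * K) ∧
      ∀ x y, |F' x - F' y| ≤ 12 * L * |x - y| := by
  have hK0 : 0 ≤ K := (abs_nonneg _).trans (hK 0)
  have hL0 : 0 ≤ L := (abs_nonneg _).trans (hL 0)
  have hcont : Continuous h := hc.continuous
  have hdiff : Differentiable ℝ h := hc.differentiable one_ne_zero
  have hint : Integrable h (gaussianReal 0 1) :=
    Integrable.of_bound hcont.aestronglyMeasurable K (ae_of_all _ hK)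
  have hlip : ∀ x y, |h x - h y| ≤ L * |x - y| := fun x y => by
    simpa using Convex.norm_image_sub_le_of_norm_deriv_le (s := Set.univ) (x := y) (y := x)
      (fun z _ => hdiff z) (fun z _ => hL z) convex_univ trivial trivial
  set m : ℝ := ∫ z, h z ∂(gaussianReal 0 1) with hm
  have hmK : |m| ≤ K := by
    have := norm_integral_le_of_norm_le_const (μ := gaussianReal 0 1) (f := h) (C := K) (ae_of_all _ hK)
    simpa using this
  have hHK : ∀ x, |h x - m| ≤ 2 * K := fun x => by
    have := abs_sub (h x) m
    linarith [hK x]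
  obtain ⟨F, hF, hlim, hlim'⟩ := exists_stein_solution (H := fun x => h x - m) (by fun_prop) hHK
    (by rw [integral_sub hint (integrable_const _)]; simp [hm])
  have hF1 : ∀ x, |F x| ≤ 4 * K / (1 + |x|) := fun x => by
    have := stein_bound (A := 2 * K) (B := 0) (by positivity) hF (by simpa using hHK) hlim hlim' x
    convert this using 1
    ring
  have hFK : ∀ x, |F x| ≤ 4 * K := fun x => abs_le_of_le_div_one_add_abs (by positivity) (hF1 x)
  have hF2 : ∀ x, |F x| ≤ 3 * L := fun x => by
    have := stein_bound (A := L) (B := L) hL0 hF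
      (abs_sub_integral_gaussianReal_le hcont hK hlip hL0) hlim hlim' x
    have h3 : 2 * L / (1 + |x|) ≤ 2 * L :=
      div_le_self (by positivity) (by linarith [abs_nonneg x])
    linarith
  -- G = F' again solves a Stein equation, with F + h' in place of H, so the same comparison bounds
  -- it by L. The bound by K serves only to check the decay of G exp(-x²/2).
  set G : ℝ → ℝ := fun x => x * F x + (h x - m) with hG
  have hGd : ∀ x, HasDerivAt G (x * G x + (F x + deriv h x)) x := fun x => by
    have := ((hasDerivAt_id x).mul (hF x)).add ((hdiff x).hasDerivAt.sub_const m)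
    refine this.congr_deriv ?_
    simp only [hG, id]; ring
  have hGK : ∀ x, |G x| ≤ 6 * K := fun x => by
    have h1 := abs_mul_le_of_le_div_one_add_abs (by positivity) (hF1 x)
    have h2 := abs_add_le (x * F x) (h x - m)
    simp only [hG]
    linarith [hHK x]
  have hGlim : Tendsto (fun x => G x * Real.exp (-x ^ 2 / 2)) (cocompact ℝ) (𝓝 0) := by
    refine squeeze_zero_norm (fun x => ?_) (tendsto_affine_mul_exp_neg_sq (6 * K) 0)
    rw [norm_mul, Real.norm_eq_abs, Real.norm_eq_abs, Real.abs_exp]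
    gcongr
    linarith [hGK x]
  have hR : ∀ x, |F x + deriv h x| ≤ 4 * L := fun x => by
    linarith [abs_add_le (F x) (deriv h x), hF2 x, hL x]
  have hG1 : ∀ x, |G x| ≤ 8 * L / (1 + |x|) := fun x => by
    have := stein_bound (A := 4 * L) (B := 0) (by positivity) hGd (by simpa using hR)
      (hGlim.mono_left atTop_le_cocompact) (hGlim.mono_left atBot_le_cocompact) x
    convert this using 1
    ring
  refine ⟨F, G, hF, fun x => rfl, hFK, hGK, fun x y => ?_⟩
  simpa using Convex.norm_image_sub_le_of_norm_hasDerivWithin_le (s := Set.univ) (x := y) (y := x)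
      -- 12 = 8 + 4: G' = zG + (F + h'), with |zG| ≤ 8L and |F + h'| ≤ 4L.
      (C := 12 * L) (fun z _ => (hGd z).hasDerivWithinAt) (fun z _ => by
        have h1 := abs_mul_le_of_le_div_one_add_abs (by positivity) (hG1 z)
        have h2 := abs_add_le (z * G z) (F z + deriv h z)
        rw [Real.norm_eq_abs]
        linarith [hR z]) convex_univ trivial trivial

/-- Stein's solution for the centred Gaussian of variance `1 / a`. -/
lemma exists_stein_solution_of_variance {a : ℝ} (ha : 0 < a) {h : ℝ → ℝ} (hc : ContDiff ℝ 1 h)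
    {K L : ℝ} (hK : ∀ x, |h x| ≤ K) (hL : ∀ x, |deriv h x| ≤ L) :
    ∃ f f' : ℝ → ℝ, (∀ x, HasDerivAt f (f' x) x) ∧
      (∀ x, f' x = a * x * f x + (h x - ∫ z, h z ∂(gaussianReal 0 (1 / a).toNNReal))) ∧
      (∀ x, |f x| ≤ 4 / √a * K) ∧ (∀ x, |f' x| ≤ 6 * K) ∧
      ∀ x y, |f' x - f' y| ≤ 12 * L * |x - y| := by
  set s := √a with hs
  have hs0 : 0 < s := Real.sqrt_pos.2 ha
  have hsa : s * s = a := Real.mul_self_sqrt ha.le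
  have hdiff : Differentiable ℝ h := hc.differentiable one_ne_zero
  have hint : ∫ z, h z ∂(gaussianReal 0 (1 / a).toNNReal) =
      ∫ z, h (s⁻¹ * z) ∂(gaussianReal 0 1) := by
    have hmap := gaussianReal_map_const_mul (μ := 0) (v := 1) s⁻¹
    have hv : (1 / a).toNNReal = NNReal.mk ((s⁻¹) ^ 2) (sq_nonneg _) * 1 := by
      ext
      rw [Real.coe_toNNReal _ (by positivity)]
      simp only [mul_one, NNReal.coe_mk]
      rw [← hsa]; field_simp
    rw [mul_zero, ← hv] at hmap
    rw [← hmap, integral_map (by fun_prop) hc.continuous.aestronglyMeasurable]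
  obtain ⟨F, F', hF, hE, h1, h2, h3⟩ := exists_stein_solution_standard
    (h := fun x => h (s⁻¹ * x)) (K := K) (L := s⁻¹ * L) (by fun_prop) (fun x => hK _)
    (fun x => by
      rw [deriv_comp_mul_left, smul_eq_mul, abs_mul, abs_of_pos (by positivity)]
      gcongr
      exact hL _)
  refine ⟨fun x => s⁻¹ * F (s * x), fun x => F' (s * x), fun x => ?_, fun x => ?_, fun x => ?_,
    fun x => h2 _, fun x y => ?_⟩
  · have := ((hF (s * x)).comp x ((hasDerivAt_id x).const_mul s)).const_mul s⁻¹
    refine this.congr_deriv ?_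
    field_simp
  · change F' (s * x) = a * x * (s⁻¹ * F (s * x)) + _
    rw [hE, hint, ← hsa, inv_mul_cancel_left₀ hs0.ne']
    field_simp
  · rw [abs_mul, abs_of_pos (by positivity)]
    calc s⁻¹ * |F (s * x)| ≤ s⁻¹ * (4 * K) := by gcongr; exact h1 _
      _ = 4 / s * K := by ring
  -- The factor s⁻¹ in the derivative of the rescaled h cancels s|x - y|, so 12L does not depend on
  -- a.
  · refine (h3 _ _).trans (le_of_eq ?_)
    rw [← mul_sub, abs_mul, abs_of_pos hs0]
    field_simp

/-! ### Fair spins and Curie-Weiss expectations -/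

lemma integral_fairSpin (f : ℝ → ℝ) : ∫ x, f x ∂fairSpin = (f 1 + f (-1)) / 2 := by
  rw [fairSpin, integral_smul_measure, integral_add_measure (integrable_dirac (by simp))
    (integrable_dirac (by simp)), integral_dirac, integral_dirac]
  simp
  ring

lemma fairSpin_ae : ∀ᵐ y ∂fairSpin, y = 1 ∨ y = -1 := by
  unfold fairSpin
  apply Measure.ae_smul_measure
  rw [ae_add_measure_iff, ae_dirac_eq, ae_dirac_eq]
  simp

lemma measurePreserving_neg_fairSpin :
    MeasurePreserving (fun y : ℝ => -y) fairSpin fairSpin where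
  measurable := measurable_neg
  map_eq := by
    rw [fairSpin, Measure.map_smul, Measure.map_add _ _ measurable_neg,
      Measure.map_dirac' measurable_neg, Measure.map_dirac' measurable_neg, neg_neg, add_comm]

lemma fairSpin_pi_ae {n : ℕ} :
    ∀ᵐ x ∂(Measure.pi fun _ : Fin n => fairSpin), ∀ k, x k = 1 ∨ x k = -1 := by
  rw [ae_all_iff]
  intro k
  exact (measurePreserving_eval (fun _ : Fin n => fairSpin) k).quasiMeasurePreserving.ae fairSpin_ae

lemma magnetisation_pi_ae {n : ℕ} :
    ∀ᵐ x ∂(Measure.pi fun _ : Fin n => fairSpin), |magnetisation x| ≤ n := by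
  filter_upwards [fairSpin_pi_ae] with x hx
  refine (Finset.abs_sum_le_sum_abs _ _).trans ?_
  refine (Finset.sum_le_sum (g := fun _ => (1 : ℝ)) fun k _ => ?_).trans (by simp)
  rcases hx k with h | h <;> simp [h]

@[fun_prop]
lemma continuous_magnetisation {n : ℕ} : Continuous (magnetisation : (Fin n → ℝ) → ℝ) := by
  unfold magnetisation
  fun_prop

lemma integrable_of_abs_magnetisation_le {n : ℕ} {μ : Measure (Fin n → ℝ)} [IsFiniteMeasure μ]
    (hμ : ∀ᵐ x ∂μ, |magnetisation x| ≤ n) {u : ℝ → ℝ} (hu : Continuous u) :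
    Integrable (fun x => u (magnetisation x)) μ := by
  obtain ⟨C, hC⟩ := (isCompact_Icc (a := -(n : ℝ)) (b := n)).exists_bound_of_continuousOn
    hu.continuousOn
  refine Integrable.of_bound (by fun_prop) C ?_
  filter_upwards [hμ] with x hx
  exact hC _ (abs_le.1 hx)

lemma integrable_comp_magnetisation {n : ℕ} {u : ℝ → ℝ} (hu : Continuous u) :
    Integrable (fun x => u (magnetisation x)) (Measure.pi fun _ : Fin n => fairSpin) :=
  integrable_of_abs_magnetisation_le magnetisation_pi_ae hu

lemma magnetisation_curieWeiss_ae {n : ℕ} {β : ℝ} :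
    ∀ᵐ x ∂(curieWeiss n β), |magnetisation x| ≤ n :=
  (tilted_absolutelyContinuous _ _).ae_le magnetisation_pi_ae

lemma integrable_comp_magnetisation_curieWeiss {n : ℕ} {β : ℝ} {u : ℝ → ℝ} (hu : Continuous u) :
    Integrable (fun x => u (magnetisation x)) (curieWeiss n β) :=
  integrable_of_abs_magnetisation_le magnetisation_curieWeiss_ae hu

/-- The normalising constant of the Curie-Weiss model. -/
noncomputable def partitionFunction (n : ℕ) (β : ℝ) : ℝ :=
  ∫ x, Real.exp (β / (2 * n) * magnetisation x ^ 2) ∂(Measure.pi fun _ : Fin n => fairSpin)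

lemma integral_curieWeiss {n : ℕ} {β : ℝ} (g : (Fin n → ℝ) → ℝ) :
    ∫ x, g x ∂(curieWeiss n β) =
      (∫ x, Real.exp (β / (2 * n) * magnetisation x ^ 2) * g x
        ∂(Measure.pi fun _ : Fin n => fairSpin)) / partitionFunction n β := by
  rw [curieWeiss, integral_tilted, ← integral_div]
  refine integral_congr_ae (ae_of_all _ fun x => ?_)
  simp only [smul_eq_mul, partitionFunction]
  ring

/-! ### The spin-flip identity -/

/-- Flipping a uniformly chosen spin preserves the law of independent fair spins. -/
lemma integral_spin_flip {n : ℕ} {u : ℝ → ℝ} (hu : Continuous u) :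
    ∫ x, (n + magnetisation x) * u (magnetisation x) ∂(Measure.pi fun _ : Fin n => fairSpin) =
      ∫ x, (n - magnetisation x) * u (magnetisation x + 2)
        ∂(Measure.pi fun _ : Fin n => fairSpin) := by
  set P := Measure.pi fun _ : Fin n => fairSpin with hP
  have hone : ∀ k : Fin n, ∫ x, (1 + x k) * u (magnetisation x) ∂P =
      ∫ x, (1 - x k) * u (magnetisation x + 2) ∂P := by
    intro k
    set flip : (Fin n → ℝ) → (Fin n → ℝ) := fun x i => if i = k then -x i else x i with hflip
    have hmp : MeasurePreserving flip P P := by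
      have := measurePreserving_pi (fun _ : Fin n => fairSpin) (fun _ : Fin n => fairSpin)
        (f := fun i y => if i = k then -y else y) (fun i => by
          by_cases h : i = k
          · simpa [h] using measurePreserving_neg_fairSpin
          · simp only [h, if_false]
            exact MeasurePreserving.id fairSpin)
      exact this
    have hmag : ∀ x, magnetisation (flip x) = magnetisation x - 2 * x k := by
      intro x
      have : ∀ i, flip x i = x i - if i = k then 2 * x k else 0 := by
        intro i
        by_cases h : i = k
        · subst h; simp [hflip]; ring
        · simp [hflip, h]
      simp [magnetisation, this, Finset.sum_sub_distrib]
    calc ∫ x, (1 + x k) * u (magnetisation x) ∂P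
        = ∫ x, (1 + flip x k) * u (magnetisation (flip x)) ∂P := by
          conv_lhs => rw [← hmp.map_eq]
          rw [integral_map hmp.measurable.aemeasurable]
          exact (Continuous.aestronglyMeasurable (by fun_prop))
      _ = ∫ x, (1 - x k) * u (magnetisation x + 2) ∂P := by
          refine integral_congr_ae ?_
          filter_upwards [fairSpin_pi_ae] with x hx
          rw [hmag]
          have : flip x k = -x k := by simp [hflip]
          rw [this]
          -- Both sides vanish when the spin is 1; when it is -1, the shift -2 x k equals 2.
          rcases hx k with h | h <;> rw [h] <;> norm_num
  have hint : ∀ (s : ℝ) (k : Fin n) {v : ℝ → ℝ}, Continuous v →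
      Integrable (fun x => (1 + s * x k) * v (magnetisation x)) P := by
    intro s k v hv
    refine (integrable_comp_magnetisation hv).bdd_mul (c := 1 + |s|)
      (Continuous.aestronglyMeasurable (by fun_prop)) ?_
    filter_upwards [fairSpin_pi_ae] with x hx
    refine (norm_add_le _ _).trans ?_
    rcases hx k with h | h <;> simp [h]
  calc ∫ x, (n + magnetisation x) * u (magnetisation x) ∂P
      = ∫ x, ∑ k, (1 + x k) * u (magnetisation x) ∂P := by
        congr 1; ext x
        rw [← Finset.sum_mul, Finset.sum_add_distrib]
        simp [magnetisation]
    _ = ∑ k, ∫ x, (1 + x k) * u (magnetisation x) ∂P :=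
        integral_finsetSum _ fun k _ => by simpa using hint 1 k hu
    _ = ∑ k, ∫ x, (1 - x k) * u (magnetisation x + 2) ∂P := Finset.sum_congr rfl fun k _ => hone k
    _ = ∫ x, ∑ k, (1 - x k) * u (magnetisation x + 2) ∂P :=
        (integral_finsetSum _ fun k _ => by
          simpa [← sub_eq_add_neg] using hint (-1) k (v := fun y => u (y + 2)) (by fun_prop)).symm
    _ = ∫ x, (n - magnetisation x) * u (magnetisation x + 2) ∂P := by
        congr 1; ext x
        rw [← Finset.sum_mul, Finset.sum_sub_distrib]
        simp [magnetisation]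

/-- The discrete Stein identity of the rescaled Curie-Weiss magnetisation. -/
lemma curieWeiss_stein_identity {n : ℕ} (hn : 1 ≤ n) (β : ℝ) {f : ℝ → ℝ} (hf : Continuous f) :
    ∫ x, ((1 + magnetisation x / n) * Real.exp (β * -(magnetisation x / n)) *
        f (magnetisation x / √n - 1 / √n) -
      (1 - magnetisation x / n) * Real.exp (β * (magnetisation x / n)) *
        f (magnetisation x / √n + 1 / √n)) ∂(curieWeiss n β) = 0 := by
  have hn0 : (n : ℝ) ≠ 0 := by positivity
  rw [integral_curieWeiss, div_eq_zero_iff]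
  left
  set w : ℝ → ℝ := fun m => Real.exp (β / (2 * n) * m ^ 2) with hw
  -- The factor exp(-βm/n) and the half-step shift in f make the outcome symmetric: w(m+2)
  -- exp(-β(m+2)/n) = w(m) exp(βm/n), with f evaluated at m/√n ∓ 1/√n.
  have hflip := integral_spin_flip (n := n)
    (u := fun m => w m * Real.exp (-β * m / n) * f (m / √n - 1 / √n)) (by fun_prop)
  have h1 : ∀ m : ℝ, w m * ((1 + m / n) * Real.exp (β * -(m / n)) * f (m / √n - 1 / √n) -
      (1 - m / n) * Real.exp (β * (m / n)) * f (m / √n + 1 / √n)) =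
      (1 / n) * ((n + m) * (w m * Real.exp (-β * m / n) * f (m / √n - 1 / √n)) -
      (n - m) * (w (m + 2) * Real.exp (-β * (m + 2) / n) * f ((m + 2) / √n - 1 / √n))) := by
    intro m
    have h2 : w (m + 2) * Real.exp (-β * (m + 2) / n) = w m * Real.exp (β * (m / n)) := by
      simp only [hw]
      rw [← Real.exp_add, ← Real.exp_add]
      congr 1
      field_simp
      ring
    rw [h2, show (m + 2) / √n - 1 / √n = m / √n + 1 / √n by ring,
      show -β * m / n = β * -(m / n) by ring]
    field_simp
  simp_rw [show ∀ m : ℝ, Real.exp (β / (2 * n) * m ^ 2) = w m from fun _ => rfl, h1]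
  rw [integral_const_mul, integral_sub, hflip, sub_self, mul_zero]
  · exact integrable_comp_magnetisation (u := fun m =>
      (n + m) * (w m * Real.exp (-β * m / n) * f (m / √n - 1 / √n))) (by fun_prop)
  · exact integrable_comp_magnetisation (u := fun m =>
      (n - m) * (w (m + 2) * Real.exp (-β * (m + 2) / n) * f ((m + 2) / √n - 1 / √n)))
      (by fun_prop)

/-! ### Moment bounds uniform in n -/

lemma integrable_exp_sq_gaussianReal {c : ℝ} (hc : c < 1) :
    Integrable (fun z : ℝ => Real.exp (c * z ^ 2 / 2)) (gaussianReal 0 1) := by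
  rw [gaussianReal_of_var_ne_zero _ one_ne_zero,
    integrable_withDensity_iff_integrable_smul' (measurable_gaussianPDF _ _)
      (ae_of_all _ fun x => gaussianPDF_lt_top)]
  simp only [toReal_gaussianPDF, gaussianPDFReal, smul_eq_mul, NNReal.coe_one, mul_one, sub_zero]
  have := (integrable_exp_neg_mul_sq (b := (1 - c) / 2) (by linarith)).const_mul
    (√(2 * Real.pi))⁻¹
  refine this.congr (ae_of_all _ fun x => ?_)
  simp only
  rw [mul_assoc, ← Real.exp_add]
  congr 2
  ring

lemma integral_exp_mul_magnetisation {n : ℕ} (t : ℝ) :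
    ∫ x, Real.exp (t * magnetisation x) ∂(Measure.pi fun _ : Fin n => fairSpin) =
      Real.cosh t ^ n := by
  have h1 : ∀ x : Fin n → ℝ, Real.exp (t * magnetisation x) = ∏ k, Real.exp (t * x k) := by
    intro x
    rw [magnetisation, Finset.mul_sum, Real.exp_sum]
  simp_rw [h1]
  rw [integral_fintype_prod_eq_pow (fun y : ℝ => Real.exp (t * y)), integral_fairSpin,
    Fintype.card_fin, Real.cosh_eq]
  simp

/-- The Hubbard-Stratonovich bound for the exponential square moments of the magnetisation. -/
lemma partitionFunction_le {n : ℕ} (hn : 1 ≤ n) {c : ℝ} (hc0 : 0 ≤ c) (hc : c < 1) :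
    partitionFunction n c ≤ ∫ z, Real.exp (c * z ^ 2 / 2) ∂(gaussianReal 0 1) := by
  have hn0 : (n : ℝ) ≠ 0 := by positivity
  set P := Measure.pi fun _ : Fin n => fairSpin with hP
  set s : ℝ := √(c / n) with hs
  have hs2 : s ^ 2 = c / n := Real.sq_sqrt (by positivity)
  have hint : Integrable (fun x => Real.exp (c / (2 * n) * magnetisation x ^ 2)) P :=
    integrable_comp_magnetisation (u := fun m => Real.exp (c / (2 * n) * m ^ 2)) (by fun_prop)
  rw [partitionFunction, ← ENNReal.ofReal_le_ofReal_iff (integral_nonneg fun _ => by positivity),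
    ofReal_integral_eq_lintegral_ofReal hint (ae_of_all _ fun _ => by positivity),
    ofReal_integral_eq_lintegral_ofReal (integrable_exp_sq_gaussianReal hc)
      (ae_of_all _ fun _ => by positivity)]
  -- Linearise the square: exp(s²m²/2) is the Gaussian expectation of exp(smZ), with s² = c/n. After
  -- Tonelli the spins factorise into cosh(sz)^n.
  have h1 : ∀ x : Fin n → ℝ, ENNReal.ofReal (Real.exp (c / (2 * n) * magnetisation x ^ 2)) =
      ∫⁻ z, ENNReal.ofReal (Real.exp (s * magnetisation x * z)) ∂(gaussianReal 0 1) := by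
    intro x
    rw [← ofReal_integral_eq_lintegral_ofReal (integrable_exp_mul_gaussianReal _)
      (ae_of_all _ fun _ => by positivity)]
    have := congrFun (mgf_fun_id_gaussianReal (μ := 0) (v := 1)) (s * magnetisation x)
    rw [mgf] at this
    rw [this]
    congr 2
    rw [mul_pow, hs2]
    simp
    field_simp
  simp_rw [h1]
  rw [lintegral_lintegral_swap (by
    refine Measurable.aemeasurable ?_
    have : Continuous fun p : (Fin n → ℝ) × ℝ => s * magnetisation p.1 * p.2 := by fun_prop
    exact (Real.continuous_exp.comp this).measurable.ennreal_ofReal)]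
  refine lintegral_mono fun z => ?_
  have h2 : ∀ x : Fin n → ℝ, s * magnetisation x * z = (s * z) * magnetisation x := fun x => by ring
  simp_rw [h2]
  rw [← ofReal_integral_eq_lintegral_ofReal
    (integrable_comp_magnetisation (u := fun m => Real.exp (s * z * m)) (by fun_prop))
    (ae_of_all _ fun _ => by positivity), integral_exp_mul_magnetisation]
  refine ENNReal.ofReal_le_ofReal ?_
  calc Real.cosh (s * z) ^ n ≤ Real.exp ((s * z) ^ 2 / 2) ^ n := by
        have := Real.cosh_pos (s * z)
        gcongr
        exact Real.cosh_le_exp_half_sq _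
    _ = Real.exp (c * z ^ 2 / 2) := by
        rw [← Real.exp_nat_mul, mul_pow, hs2]
        congr 1
        field_simp

/-- Only uniformity in n matters, so q/4 ≤ exp(q/4), with q = M²/n, is compared with the partition
function at inverse temperature 1/2. -/
lemma integral_sq_magnetisation_le :
    ∃ K : ℝ, 0 ≤ K ∧ ∀ n : ℕ, 1 ≤ n →
      ∫ x, magnetisation x ^ 2 / n ∂(Measure.pi fun _ : Fin n => fairSpin) ≤ K := by
  refine ⟨4 * ∫ z, Real.exp (1 / 2 * z ^ 2 / 2) ∂(gaussianReal 0 1),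
    mul_nonneg (by norm_num) (integral_nonneg fun _ => by positivity), fun n hn => ?_⟩
  have hn0 : (0 : ℝ) < n := by positivity
  refine le_trans ?_ (mul_le_mul_of_nonneg_left
    (partitionFunction_le hn (c := 1 / 2) (by norm_num) (by norm_num)) (by norm_num))
  rw [partitionFunction, ← integral_const_mul]
  refine integral_mono (integrable_comp_magnetisation (u := fun m => m ^ 2 / n) (by fun_prop))
    (integrable_comp_magnetisation
      (u := fun m => 4 * Real.exp (1 / 2 / (2 * n) * m ^ 2)) (by fun_prop)) fun x => ?_
  have := Real.add_one_le_exp (1 / 2 / (2 * n) * magnetisation x ^ 2)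
  have h2 : 1 / 2 / (2 * n) * magnetisation x ^ 2 = magnetisation x ^ 2 / n / 4 := by
    field_simp; ring
  simp only
  rw [h2] at this ⊢
  linarith

/-- Jensen by hand: bound exp(βq/2), q = M²/n, below by the tangent line of exp at -t with t = |β|K,
then integrate using E q ≤ K. -/
lemma exists_le_partitionFunction (β : ℝ) :
    ∃ c : ℝ, 0 < c ∧ ∀ n : ℕ, 1 ≤ n → c ≤ partitionFunction n β := by
  obtain ⟨K, hK0, hK⟩ := integral_sq_magnetisation_le
  refine ⟨Real.exp (-(|β| * K)), Real.exp_pos _, fun n hn => ?_⟩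
  have hn0 : (0 : ℝ) < n := by positivity
  set P := Measure.pi fun _ : Fin n => fairSpin with hP
  set t : ℝ := |β| * K with ht
  have hi : Integrable (fun x => -|β| / 2 * (magnetisation x ^ 2 / n)) P :=
    integrable_comp_magnetisation (u := fun m => -|β| / 2 * (m ^ 2 / n)) (by fun_prop)
  calc Real.exp (-t) ≤ Real.exp (-t) *
        ((1 + t) + -|β| / 2 * ∫ x, magnetisation x ^ 2 / n ∂P) := by
        have := mul_le_mul_of_nonneg_left (hK n hn) (abs_nonneg β)
        have h0 : 0 ≤ t := by positivity
        refine le_mul_of_one_le_right (Real.exp_pos _).le ?_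
        linarith
    _ = ∫ x, Real.exp (-t) * ((1 + t) + -|β| / 2 * (magnetisation x ^ 2 / n)) ∂P := by
        rw [integral_const_mul, integral_add (integrable_const _) hi, integral_const_mul]
        simp
    _ ≤ partitionFunction n β := by
        refine integral_mono (integrable_comp_magnetisation (u := fun m =>
          Real.exp (-t) * ((1 + t) + -|β| / 2 * (m ^ 2 / n))) (by fun_prop))
          (integrable_comp_magnetisation
            (u := fun m => Real.exp (β / (2 * n) * m ^ 2)) (by fun_prop)) fun x => ?_
        simp only
        set q : ℝ := magnetisation x ^ 2 / n with hq
        have hq0 : 0 ≤ q := by positivity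
        have h1 : β / (2 * n) * magnetisation x ^ 2 = -t + (β / 2 * q + t) := by
          simp only [hq]; ring
        rw [h1, Real.exp_add]
        gcongr
        have h2 := Real.add_one_le_exp (β / 2 * q + t)
        have h3 : -|β| * q ≤ β * q := mul_le_mul_of_nonneg_right (neg_abs_le β) hq0
        linarith

/-- The fourth moments of the rescaled magnetisation are bounded at high temperature. -/
lemma exists_fourth_moment_curieWeiss_le {β : ℝ} (hβ : β < 1) :
    ∃ K : ℝ, ∀ n : ℕ, 1 ≤ n → ∫ x, (magnetisation x / √n) ^ 4 ∂(curieWeiss n β) ≤ K := by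
  obtain ⟨c, hc0, hc⟩ := exists_le_partitionFunction β
  -- The spare exponent l - β pays for the fourth power, through y²/2 ≤ exp y with y = (l-β)m²/(2n);
  -- l < 1 keeps the Gaussian integral finite.
  obtain ⟨l, hl1, hl2⟩ := exists_between (max_lt hβ (zero_lt_one' ℝ))
  have hlβ : 0 < l - β := by linarith [le_max_left β 0]
  have hl0 : 0 ≤ l := (le_max_right β 0).trans hl1.le
  set A := ∫ z, Real.exp (l * z ^ 2 / 2) ∂(gaussianReal 0 1) with hA
  have hA0 : 0 ≤ A := integral_nonneg fun _ => by positivity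
  refine ⟨8 / (l - β) ^ 2 * A / c, fun n hn => ?_⟩
  have hn0 : (0 : ℝ) < n := by positivity
  rw [integral_curieWeiss]
  refine div_le_div₀ (by positivity) ?_ hc0 (hc n hn)
  refine le_trans ?_ (mul_le_mul_of_nonneg_left (partitionFunction_le hn hl0 hl2) (by positivity))
  rw [partitionFunction, ← integral_const_mul]
  refine integral_mono (integrable_comp_magnetisation (u := fun m =>
      Real.exp (β / (2 * n) * m ^ 2) * (m / √n) ^ 4) (by fun_prop))
    (integrable_comp_magnetisation (u := fun m =>
      8 / (l - β) ^ 2 * Real.exp (l / (2 * n) * m ^ 2)) (by fun_prop)) fun x => ?_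
  simp only
  set m := magnetisation x
  set y : ℝ := (l - β) / (2 * n) * m ^ 2 with hy
  have hy0 : 0 ≤ y := by positivity
  have h1 : (m / √n) ^ 4 = 8 / (l - β) ^ 2 * (y ^ 2 / 2) := by
    have : (m / √n) ^ 4 = (m ^ 2 / n) ^ 2 := by
      rw [show (m / √n) ^ 4 = (m ^ 2 / √n ^ 2) ^ 2 by ring, Real.sq_sqrt hn0.le]
    rw [this, hy]
    field_simp
    norm_num
  have h2 : l / (2 * n) * m ^ 2 = β / (2 * n) * m ^ 2 + y := by rw [hy]; ring
  rw [h1, h2, Real.exp_add]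
  have h3 := Real.quadratic_le_exp_of_nonneg hy0
  calc _ = 8 / (l - β) ^ 2 * (Real.exp (β / (2 * n) * m ^ 2) * (y ^ 2 / 2)) := by ring
    _ ≤ _ := by gcongr; linarith

/-! ### From the discrete to the Gaussian Stein operator -/

lemma exists_abs_tilt_sub_le (β : ℝ) : ∃ C : ℝ, 0 ≤ C ∧ ∀ t : ℝ, |t| ≤ 1 →
    |(1 - t) * Real.exp (β * t) - (1 - (1 - β) * t + (β ^ 2 / 2 - β) * t ^ 2)| ≤ C * |t| ^ 3 := by
  refine ⟨β ^ 2 / 2 + 2 * (|β| ^ 3 * Real.exp |β|), by positivity, fun t ht => ?_⟩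
  set r : ℝ := Real.exp (β * t) - (1 + β * t + (β * t) ^ 2 / 2) with hr
  have hr1 : |r| ≤ |β| ^ 3 * Real.exp |β| * |t| ^ 3 := by
    have h1 := Complex.norm_exp_sub_sum_le_norm_mul_exp ((β * t : ℝ) : ℂ) 3
    have h2 : Complex.exp ((β * t : ℝ) : ℂ) -
        ∑ m ∈ Finset.range 3, ((β * t : ℝ) : ℂ) ^ m / (m.factorial : ℂ) = (r : ℂ) := by
      simp only [Finset.sum_range_succ, hr, Finset.sum_range_zero]
      push_cast
      simp
    rw [h2, Complex.norm_real, Complex.norm_real, Real.norm_eq_abs, Real.norm_eq_abs] at h1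
    have h3 : |β * t| ≤ |β| := by
      rw [abs_mul]
      exact mul_le_of_le_one_right (abs_nonneg _) ht
    calc |r| ≤ |β * t| ^ 3 * Real.exp |β * t| := h1
      _ ≤ |β * t| ^ 3 * Real.exp |β| := by gcongr
      _ = _ := by rw [abs_mul]; ring
  have h4 : (1 - t) * Real.exp (β * t) - (1 - (1 - β) * t + (β ^ 2 / 2 - β) * t ^ 2) =
      -(β ^ 2 / 2) * t ^ 3 + (1 - t) * r := by
    simp only [hr]; ring
  rw [h4]
  have h5 : |1 - t| ≤ 2 := by
    rw [abs_le] at ht ⊢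
    constructor <;> linarith
  calc |-(β ^ 2 / 2) * t ^ 3 + (1 - t) * r| ≤ |-(β ^ 2 / 2) * t ^ 3| + |(1 - t) * r| :=
        abs_add_le _ _
    _ = β ^ 2 / 2 * |t| ^ 3 + |1 - t| * |r| := by
        rw [abs_mul, abs_mul, abs_neg, abs_pow, abs_of_nonneg (show 0 ≤ β ^ 2 / 2 by positivity)]
    _ ≤ β ^ 2 / 2 * |t| ^ 3 + 2 * (|β| ^ 3 * Real.exp |β| * |t| ^ 3) := by gcongr
    _ = _ := by ring

/-- The even and odd parts of the flip rates of the Curie-Weiss model near zero magnetisation. -/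
lemma exists_tilt_even_odd_bounds (β : ℝ) : ∃ C : ℝ, 0 ≤ C ∧ ∀ t : ℝ, |t| ≤ 1 →
    |(1 - t) * Real.exp (β * t) + (1 + t) * Real.exp (β * -t) - 2| ≤ 2 * C * |t| ^ 2 ∧
    |(1 - t) * Real.exp (β * t) - (1 + t) * Real.exp (β * -t) + 2 * (1 - β) * t| ≤
      2 * C * |t| ^ 3 := by
  obtain ⟨C, hC0, hC⟩ := exists_abs_tilt_sub_le β
  refine ⟨|β ^ 2 / 2 - β| + C, by positivity, fun t ht => ?_⟩
  have h1 := hC t ht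
  have h2 := hC (-t) (by rwa [abs_neg])
  rw [abs_neg, sub_neg_eq_add, neg_sq] at h2
  have h3 : |t| ^ 3 ≤ |t| ^ 2 := pow_le_pow_of_le_one (abs_nonneg t) ht (by norm_num)
  have h4 : |(β ^ 2 / 2 - β) * t ^ 2| = |β ^ 2 / 2 - β| * |t| ^ 2 := by rw [abs_mul, abs_pow]
  have h5 : C * |t| ^ 3 ≤ C * |t| ^ 2 := by gcongr
  have h6 : 0 ≤ |β ^ 2 / 2 - β| * |t| ^ 3 := by positivity
  constructor
  · rw [abs_le] at h1 h2 ⊢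
    have := abs_le.1 h4.le
    constructor <;> linarith
  -- The quadratic terms cancel in the odd part, so its remainder is cubic; this is what leaves an
  -- error of order 1/n.
  · rw [abs_le] at h1 h2 ⊢
    constructor <;> linarith

/-- Mean value inequality for y ↦ f y - f' x * y on the ball of radius |d|; no second derivative is
needed. -/
lemma abs_sub_sub_mul_le_of_lipschitz_deriv {f f' : ℝ → ℝ} {M : ℝ}
    (hf : ∀ x, HasDerivAt f (f' x) x) (hM : ∀ x y, |f' x - f' y| ≤ M * |x - y|) (hM0 : 0 ≤ M)
    (x d : ℝ) : |f (x + d) - f x - f' x * d| ≤ M * d ^ 2 := by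
  have hy : x + d ∈ Metric.closedBall x |d| := by simp
  have hx : x ∈ Metric.closedBall x |d| := by simp
  have := Convex.norm_image_sub_le_of_norm_hasDerivWithin_le (f := fun y => f y - f' x * y)
    (f' := fun y => f' y - f' x) (C := M * |d|)
    (fun y _ => (((hf y).sub ((hasDerivAt_id y).const_mul (f' x))).congr_deriv
      (by ring)).hasDerivWithinAt)
    (fun y hy => (hM y x).trans (by
      rw [Metric.mem_closedBall, Real.dist_eq] at hy
      gcongr)) (convex_closedBall x |d|) hx hy
  rw [add_sub_cancel_left, Real.norm_eq_abs, Real.norm_eq_abs, mul_assoc, ← sq, sq_abs] at this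
  convert this using 2
  ring

lemma pow_abs_le_one_add_pow_four (x : ℝ) : |x| ≤ 1 + x ^ 4 ∧ |x| ^ 2 ≤ 1 + x ^ 4 ∧
    |x| ^ 3 ≤ 1 + x ^ 4 := by
  have hx := abs_nonneg x
  have h4 : x ^ 4 = |x| ^ 4 := by
    rw [← abs_pow, abs_of_nonneg (by positivity)]
  rw [h4]
  rcases le_total |x| 1 with h | h
  · have : 0 ≤ |x| ^ 4 := by positivity
    have h2 := pow_le_one₀ hx h (n := 2)
    have h3 := pow_le_one₀ hx h (n := 3)
    exact ⟨by linarith, by linarith, by linarith⟩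
  · have h1 := pow_le_pow_right₀ h (show 1 ≤ 4 by norm_num)
    have h2 := pow_le_pow_right₀ h (show 2 ≤ 4 by norm_num)
    have h3 := pow_le_pow_right₀ h (show 3 ≤ 4 by norm_num)
    rw [pow_one] at h1
    exact ⟨by linarith, by linarith, by linarith⟩

/-- The discrete Stein operator is close to the Gaussian one. -/
lemma abs_discrete_stein_add_le {β C M0 M1 M2 ε x : ℝ} {f f' : ℝ → ℝ} (hβ : β < 1) (hε : 0 < ε)
    (hC0 : 0 ≤ C) (hC : ∀ t : ℝ, |t| ≤ 1 →
      |(1 - t) * Real.exp (β * t) + (1 + t) * Real.exp (β * -t) - 2| ≤ 2 * C * |t| ^ 2 ∧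
      |(1 - t) * Real.exp (β * t) - (1 + t) * Real.exp (β * -t) + 2 * (1 - β) * t| ≤
        2 * C * |t| ^ 3)
    (hf : ∀ x, HasDerivAt f (f' x) x) (h0 : ∀ x, |f x| ≤ M0) (h1 : ∀ x, |f' x| ≤ M1)
    (h2 : ∀ x y, |f' x - f' y| ≤ M2 * |x - y|) (hM2 : 0 ≤ M2) (hx : |ε * x| ≤ 1) :
    |(1 + ε * x) * Real.exp (β * -(ε * x)) * f (x - ε) -
      (1 - ε * x) * Real.exp (β * (ε * x)) * f (x + ε) +
        2 * ε * (f' x - (1 - β) * x * f x)| ≤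
      2 * M2 * ε ^ 2 + 2 * ε ^ 3 * (C * M1 + C * M0 + (1 - β) * M2) * (1 + x ^ 4) := by
  have ha : 0 < 1 - β := by linarith
  have hM0 : 0 ≤ M0 := (abs_nonneg _).trans (h0 0)
  have hM1 : 0 ≤ M1 := (abs_nonneg _).trans (h1 0)
  obtain ⟨hS, hT⟩ := hC _ hx
  obtain ⟨hx1, hx2, hx3⟩ := pow_abs_le_one_add_pow_four x
  set P := (1 - ε * x) * Real.exp (β * (ε * x))
  set Q := (1 + ε * x) * Real.exp (β * -(ε * x))
  have hp := abs_sub_sub_mul_le_of_lipschitz_deriv hf h2 hM2 x ε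
  have hq := abs_sub_sub_mul_le_of_lipschitz_deriv hf h2 hM2 x (-ε)
  rw [← sub_eq_add_neg, neg_sq] at hq
  have hD : |f (x + ε) - f (x - ε)| ≤ M1 * (2 * ε) := by
    have := Convex.norm_image_sub_le_of_norm_hasDerivWithin_le (s := Set.univ) (x := x - ε)
      (y := x + ε) (C := M1) (fun z _ => (hf z).hasDerivWithinAt) (fun z _ => h1 z)
      convex_univ trivial trivial
    rw [Real.norm_eq_abs, Real.norm_eq_abs, show x + ε - (x - ε) = 2 * ε by ring,
      abs_of_pos (show 0 < 2 * ε by positivity)] at this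
    exact this
  have hD2 : |f (x + ε) - f (x - ε) - 2 * ε * f' x| ≤ 2 * M2 * ε ^ 2 := by
    rw [abs_le] at hp hq ⊢
    constructor <;> linarith
  have hA : |f (x + ε) + f (x - ε)| ≤ 2 * M0 := by
    linarith [abs_add_le (f (x + ε)) (f (x - ε)), h0 (x + ε), h0 (x - ε)]
  have hA2 : |f (x + ε) + f (x - ε) - 2 * f x| ≤ 2 * M2 * ε ^ 2 := by
    rw [abs_le] at hp hq ⊢
    constructor <;> linarith
  have hεx : |ε * x| = ε * |x| := by rw [abs_mul, abs_of_pos hε]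
  rw [hεx, mul_pow] at hS hT
  -- Split the rates and the values of f into even and odd parts. Only the central difference error
  -- `hD2` is of order ε²; the other three terms are of order ε³.
  have hdecomp : Q * f (x - ε) - P * f (x + ε) + 2 * ε * (f' x - (1 - β) * x * f x) =
      -((P + Q - 2) / 2 * (f (x + ε) - f (x - ε))) - (f (x + ε) - f (x - ε) - 2 * ε * f' x) -
        (P - Q + 2 * (1 - β) * (ε * x)) / 2 * (f (x + ε) + f (x - ε)) +
        (1 - β) * (ε * x) * (f (x + ε) + f (x - ε) - 2 * f x) := by ring
  have t1 : |(P + Q - 2) / 2 * (f (x + ε) - f (x - ε))| ≤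
      2 * ε ^ 3 * (C * M1) * (1 + x ^ 4) := by
    rw [abs_mul, abs_div, abs_two]
    calc |P + Q - 2| / 2 * |f (x + ε) - f (x - ε)| ≤
        (2 * C * (ε ^ 2 * |x| ^ 2)) / 2 * (M1 * (2 * ε)) := by gcongr
      _ = 2 * ε ^ 3 * (C * M1) * |x| ^ 2 := by ring
      _ ≤ _ := by gcongr
  have t2 : |(P - Q + 2 * (1 - β) * (ε * x)) / 2 * (f (x + ε) + f (x - ε))| ≤
      2 * ε ^ 3 * (C * M0) * (1 + x ^ 4) := by
    rw [abs_mul, abs_div, abs_two]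
    calc |P - Q + 2 * (1 - β) * (ε * x)| / 2 * |f (x + ε) + f (x - ε)| ≤
        (2 * C * (ε ^ 3 * |x| ^ 3)) / 2 * (2 * M0) := by gcongr
      _ = 2 * ε ^ 3 * (C * M0) * |x| ^ 3 := by ring
      _ ≤ _ := by gcongr
  have t3 : |(1 - β) * (ε * x) * (f (x + ε) + f (x - ε) - 2 * f x)| ≤
      2 * ε ^ 3 * ((1 - β) * M2) * (1 + x ^ 4) := by
    rw [abs_mul, abs_mul, hεx, abs_of_pos ha]
    calc (1 - β) * (ε * |x|) * |f (x + ε) + f (x - ε) - 2 * f x| ≤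
        (1 - β) * (ε * |x|) * (2 * M2 * ε ^ 2) := by gcongr
      _ = 2 * ε ^ 3 * ((1 - β) * M2) * |x| := by ring
      _ ≤ _ := by gcongr
  rw [hdecomp]
  rw [abs_le] at t1 t2 t3 hD2 ⊢
  constructor <;> linarith

/-! ### The quantitative bound and the absorption of constants -/

/-- Gaussian approximation with the dependence on the test function made explicit. -/
lemma exists_curieWeiss_gaussian_bound {β : ℝ} (hβ : β < 1) :
    ∃ A B : ℝ, 0 ≤ A ∧ 0 ≤ B ∧ ∀ n : ℕ, 1 ≤ n → ∀ h : ℝ → ℝ, ContDiff ℝ 1 h → ∀ K L : ℝ,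
      (∀ x, |h x| ≤ K) → (∀ x, |deriv h x| ≤ L) →
        |(∫ x, h (magnetisation x / √n) ∂(curieWeiss n β)) -
            ∫ z, h z ∂(gaussianReal 0 (1 / (1 - β)).toNNReal)| ≤
          12 * L / √n + (A * K + B * L) / n := by
  have ha : 0 < 1 - β := by linarith
  obtain ⟨C, hC0, hC⟩ := exists_tilt_even_odd_bounds β
  obtain ⟨R', hR'⟩ := exists_fourth_moment_curieWeiss_le hβ
  set R := 1 + max R' 0 with hR
  have hR0 : 0 ≤ R := by positivity
  -- The coefficients of K and L in R * D, with D defined below and R bounding 1 + E x⁴.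
  refine ⟨R * (6 * C + C * (4 / √(1 - β))), R * (12 * (1 - β)), by positivity, by positivity,
    fun n hn h hh K L hK hL => ?_⟩
  have hK0 : 0 ≤ K := (abs_nonneg _).trans (hK 0)
  have hL0 : 0 ≤ L := (abs_nonneg _).trans (hL 0)
  have hn0 : (0 : ℝ) < n := by positivity
  obtain ⟨f, f', hf, hfE, h0, h1, h2⟩ := exists_stein_solution_of_variance ha hh hK hL
  set m : ℝ := ∫ z, h z ∂(gaussianReal 0 (1 / (1 - β)).toNNReal) with hm
  set ε : ℝ := 1 / √n with hε
  have hε0 : 0 < ε := by positivity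
  have hε2 : ε ^ 2 = 1 / n := by rw [hε, div_pow, Real.sq_sqrt hn0.le, one_pow]
  have hfc : Continuous f := continuous_iff_continuousAt.2 fun x => (hf x).continuousAt
  have hid := curieWeiss_stein_identity hn β hfc
  set u : ℝ → ℝ := fun y => (1 + y / n) * Real.exp (β * -(y / n)) * f (y / √n - 1 / √n) -
      (1 - y / n) * Real.exp (β * (y / n)) * f (y / √n + 1 / √n) with hu
  have huc : Continuous u := by fun_prop
  have hhc : Continuous h := hh.continuous
  set D : ℝ := C * (6 * K) + C * (4 / √(1 - β) * K) + (1 - β) * (12 * L) with hD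
  have hD0 : 0 ≤ D := by positivity
  have hpt : ∀ᵐ x ∂(curieWeiss n β),
      |u (magnetisation x) + 2 * ε * (h (magnetisation x / √n) - m)| ≤
        2 * (12 * L) * ε ^ 2 + 2 * ε ^ 3 * D * (1 + (magnetisation x / √n) ^ 4) := by
    filter_upwards [magnetisation_curieWeiss_ae] with x hx
    have hεx : ε * (magnetisation x / √n) = magnetisation x / n := by
      rw [hε, div_mul_div_comm, one_mul, Real.mul_self_sqrt hn0.le]
    have hle : |ε * (magnetisation x / √n)| ≤ 1 := by
      rw [hεx, abs_div, abs_of_pos hn0, div_le_one hn0]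
      exact hx
    have := abs_discrete_stein_add_le hβ hε0 hC0 hC hf h0 h1 h2 (by positivity) hle
    rw [hεx] at this
    convert this using 3
    rw [hfE]; ring
  have hhi : Integrable (fun x => h (magnetisation x / √n) - m) (curieWeiss n β) :=
    integrable_comp_magnetisation_curieWeiss (u := fun y => h (y / √n) - m) (by fun_prop)
  have hhi' : Integrable (fun x => h (magnetisation x / √n)) (curieWeiss n β) :=
    integrable_comp_magnetisation_curieWeiss (u := fun y => h (y / √n)) (by fun_prop)
  have h4i : Integrable (fun x => (magnetisation x / √n) ^ 4) (curieWeiss n β) :=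
    integrable_comp_magnetisation_curieWeiss (u := fun y => (y / √n) ^ 4) (by fun_prop)
  have h4i' : Integrable (fun x => 2 * ε ^ 3 * D * (1 + (magnetisation x / √n) ^ 4))
      (curieWeiss n β) :=
    integrable_comp_magnetisation_curieWeiss (u := fun y => 2 * ε ^ 3 * D * (1 + (y / √n) ^ 4))
      (by fun_prop)
  have hui : Integrable (fun x => u (magnetisation x)) (curieWeiss n β) :=
    integrable_comp_magnetisation_curieWeiss huc
  have hlhs : ∫ x, (u (magnetisation x) + 2 * ε * (h (magnetisation x / √n) - m))
      ∂(curieWeiss n β) =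
      2 * ε * ((∫ x, h (magnetisation x / √n) ∂(curieWeiss n β)) - m) := by
    rw [integral_add hui (hhi.const_mul _), hid, zero_add, integral_const_mul,
      integral_sub hhi' (integrable_const _)]
    simp
  have hrhs : ∫ x, (2 * (12 * L) * ε ^ 2 + 2 * ε ^ 3 * D * (1 + (magnetisation x / √n) ^ 4))
      ∂(curieWeiss n β) ≤ 2 * ε * (12 * L * ε + ε ^ 2 * D * R) := by
    rw [integral_add (integrable_const _) h4i',
      integral_const_mul (2 * ε ^ 3 * D), integral_add (integrable_const _) h4i]
    simp only [integral_const, probReal_univ, smul_eq_mul, one_mul]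
    have h5 : 1 + ∫ x, (magnetisation x / √n) ^ 4 ∂(curieWeiss n β) ≤ R := by
      linarith [hR' n hn, le_max_left R' 0]
    calc _ ≤ 2 * (12 * L) * ε ^ 2 + 2 * ε ^ 3 * D * R := by gcongr
      _ = _ := by ring
  have hmain := (abs_integral_le_integral_abs (μ := curieWeiss n β) (f := fun x =>
    u (magnetisation x) + 2 * ε * (h (magnetisation x / √n) - m))).trans
    ((integral_mono_ae (hui.add (hhi.const_mul _)).abs
      ((integrable_const _).add h4i') hpt).trans hrhs)
  rw [hlhs, abs_mul, abs_of_pos (show 0 < 2 * ε by positivity)] at hmain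
  refine (le_of_mul_le_mul_left hmain (by positivity)).trans (le_of_eq ?_)
  rw [hε2, hε, hD]
  ring

lemma abs_integral_sub_integral_le_two_mul {α : Type*} {mα : MeasurableSpace α} {μ : Measure α}
    {ν : Measure ℝ} [IsProbabilityMeasure μ] [IsProbabilityMeasure ν] {h : ℝ → ℝ} {g : α → ℝ}
    {K : ℝ} (hK : ∀ x, |h x| ≤ K) : |∫ x, h (g x) ∂μ - ∫ z, h z ∂ν| ≤ 2 * K := by
  have h1 : |∫ x, h (g x) ∂μ| ≤ K := by
    simpa using norm_integral_le_of_norm_le_const (μ := μ) (f := fun x => h (g x)) (C := K)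
      (ae_of_all _ fun x => hK _)
  have h2 : |∫ z, h z ∂ν| ≤ K := by
    simpa using norm_integral_le_of_norm_le_const (μ := ν) (f := h) (C := K) (ae_of_all _ hK)
  have := abs_sub (∫ x, h (g x) ∂μ) (∫ z, h z ∂ν)
  linarith

theorem theorem3p1 :
    ∃ C : ℝ, 0 < C ∧ ∀ β : ℝ, β < 1 → ∃ Cβ : ℝ, 0 < Cβ ∧
      ∀ n : ℕ, 1 ≤ n → ∀ h : ℝ → ℝ, ContDiff ℝ 1 h →
        BddAbove (Set.range fun x => |h x|) →
        BddAbove (Set.range fun x => |deriv h x|) →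
        |(∫ x, h (magnetisation x / √n) ∂(curieWeiss n β)) -
            ∫ z, h z ∂(gaussianReal 0 (1 / (1 - β)).toNNReal)| ≤
          C * supNorm (deriv h) / √n +
            1 / n * (β / (1 - β) * supNorm (deriv h) + Cβ * supNorm h) := by
  -- 14 = 12 + 1 + 1: one unit absorbs BL/n, the other the possibly negative β/(1-β) term, which is
  -- at least -L/n.
  refine ⟨14, by norm_num, fun β hβ => ?_⟩
  have ha : 0 < 1 - β := by linarith
  obtain ⟨A, B, hA, hB, hAB⟩ := exists_curieWeiss_gaussian_bound hβ
  refine ⟨A + 2 * B ^ 2 + 1, by positivity, fun n hn h hh hb hb' => ?_⟩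
  have hK : ∀ x, |h x| ≤ supNorm h := fun x => le_ciSup hb x
  have hL : ∀ x, |deriv h x| ≤ supNorm (deriv h) := fun x => le_ciSup hb' x
  set K := supNorm h
  set L := supNorm (deriv h)
  have hK0 : 0 ≤ K := (abs_nonneg _).trans (hK 0)
  have hL0 : 0 ≤ L := (abs_nonneg _).trans (hL 0)
  have hn0 : (0 : ℝ) < n := by positivity
  set s : ℝ := √n with hs
  have hs0 : 0 < s := Real.sqrt_pos.2 hn0
  have hs1 : 1 ≤ s := Real.one_le_sqrt.2 (by exact_mod_cast hn)
  have hsn : (n : ℝ) = s ^ 2 := (Real.sq_sqrt hn0.le).symm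
  have hLn : L / n ≤ L / s := by
    rw [hsn]
    exact div_le_div_of_nonneg_left hL0 hs0 (by nlinarith)
  have hβL : -(L / s) ≤ 1 / n * (β / (1 - β) * L) := by
    have h1 : β / (1 - β) = 1 / (1 - β) - 1 := by field_simp; ring
    have h2 : 0 ≤ 1 / n * (1 / (1 - β) * L) := by positivity
    rw [h1]
    linarith [show 1 / n * ((1 / (1 - β) - 1) * L) = 1 / n * (1 / (1 - β) * L) - L / n by ring]
  have hKn : 0 ≤ K / n := by positivity
  have hsplit : 14 * L / s + 1 / n * (β / (1 - β) * L + (A + 2 * B ^ 2 + 1) * K) =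
      14 * (L / s) + 1 / n * (β / (1 - β) * L) + A * (K / n) + 2 * (B ^ 2 * (K / n)) + K / n := by
    ring
  rw [hsplit]
  have hLs : 0 ≤ L / s := by positivity
  -- If B ≤ √n then BL/n ≤ L/√n. Otherwise n ≤ B², and the trivial bound 2K is at most 2B²K/n.
  rcases le_total B s with hBs | hBs
  · have h1 := hAB n hn h hh K L hK hL
    have h2 : B * (L / n) ≤ L / s := by
      calc B * (L / n) ≤ s * (L / n) := by gcongr
        _ = L / s := by rw [hsn]; field_simp
    have h3 : 12 * L / √n + (A * K + B * L) / n = 12 * (L / s) + A * (K / n) + B * (L / n) := by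
      ring
    rw [h3] at h1
    have h4 : 0 ≤ B ^ 2 * (K / n) := by positivity
    linarith
  · have h1 := abs_integral_sub_integral_le_two_mul (μ := curieWeiss n β)
      (ν := gaussianReal 0 (1 / (1 - β)).toNNReal) (g := fun x => magnetisation x / s) hK
    have h2 : K ≤ B ^ 2 * (K / n) := by
      calc K = s ^ 2 * (K / n) := by rw [hsn]; field_simp
        _ ≤ B ^ 2 * (K / n) := by gcongr
    have h4 : 0 ≤ A * (K / n) := by positivity
    linarith
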